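/- Notation. $\langle\xi\rangle=(1+|\xi|^2)^{1/2}$, $\widehat u(\xi)=\int e^{-i\langle x,\xi\rangle}u(x)\,dx$ (extended to $\mathcal S'(\mathbb R^n)$ by duality), $\tau_y\chi=\chi(\cdot-y)$. A weight $k\in\mathcal K_{pol}(\mathbb R^n)$ is a positive measurable function on $\mathbb R^n$ for which there are constants $C,N>0$ with $$k(\xi+\eta)\le C\langle\xi\rangle^N k(\eta),\qquad \xi,\eta\in\mathbb R^n. \tag{1}$$ For $v\in\mathcal S'(\mathbb R^n)$ such that $\widehat v$ is a function put $\|v\|_{\mathcal B_k}=\|k\widehat v\|_{L^2}$ (and $\|v\|_{\mathcal B_k}=\infty$ if $\widehat v$ is not a function). For $1\le p\le\infty$, $u\in\mathcal D'(\mathbb R^n)$ and $\chi\in C_0^\infty(\mathbb R^n)\setminus 0$ put $$\|u\|_{k,p,\chi}=\Big(\int\|u\,\tau_y\chi\|_{\mathcal B_k}^p\,dy\Big)^{1/p}\ (p<\infty),\qquad \|u\|_{k,\infty,\chi}=\sup_y\|u\,\tau_y\chi\|_{\mathcal B_k};$$ $u$ belongs to $\mathcal B_k^p(\mathbb R^n)$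 if for some $\chi\in C_0^\infty\setminus 0$ the function $y\mapsto\|u\,\tau_y\chi\|_{\mathcal B_k}$ belongs to $L^p$. Let $$U_{\chi,p}(\xi)=\Big(\int|\widehat{u\tau_y\chi}(\xi)|^p\,dy\Big)^{1/p}\ (p<\infty),\qquad U_{\chi,\infty}(\xi)=\sup_y|\widehat{u\tau_y\chi}(\xi)|,$$ where $\widehat{u\tau_y\chi}(\xi)=\langle u,e^{-i\langle\cdot,\xi\rangle}\chi(\cdot-y)\rangle$; $u$ belongs to $S_w^p(\mathbb R^n)$ if $U_{\chi,p}\in L^1(\mathbb R^n)$ for some $\chi\in C_0^\infty\setminus 0$, and $\|u\|_{S_w^p,\chi}=\|U_{\chi,p}\|_{L^1}$. (The topologies of $\mathcal B_k^p$ and $S_w^p$ given by these norms do not depend on $\chi$.) Finally $\|\chi\|_{H^N}=\|\langle\cdot\rangle^N\widehat\chi\|_{L^2}$. Theorem. Let $k\in\mathcal K_{pol}(\mathbb R^n)$ with $1/k\in L^1(\mathbb R^n)$ and let $1\le p\le\infty$. Then $\mathcal B_k^p(\mathbb R^n)\hookrightarrow S_w^p(\mathbb R^n)$ continuously, that is,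 $\mathcal B_k^p(\mathbb R^n)\subset S_w^p(\mathbb R^n)$ and for all $\chi,\widetilde\chi\in C_0^\infty(\mathbb R^n)\setminus 0$ there is a finite constant $A$ with $\|u\|_{S_w^p,\chi}\le A\|u\|_{k,p,\widetilde\chi}$ for all $u\in\mathcal B_k^p(\mathbb R^n)$. Moreover, if $C,N>0$ are any constants for which (1) holds, and $\chi,\widetilde\chi\in C_0^\infty(\mathbb R^n)\setminus 0$ satisfy $\widetilde\chi=1$ on $\operatorname{supp}\chi$, then $$\|u\|_{S_w^p,\chi}\le(2\pi)^{-n}\,C\,\|\chi\|_{H^N}\,\|1/k\|_{L^1}\,\|u\|_{k,p,\widetilde\chi},\qquad u\in\mathcal B_k^p(\mathbb R^n).$$ -/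

import Mathlib

open MeasureTheory TopologicalSpace SchwartzMap
open scoped ENNReal Distributions FourierTransform

noncomputable section

namespace KatoSobolev

/-- The Euclidean space `ℝⁿ`. -/
abbrev Rn (n : ℕ) : Type := EuclideanSpace ℝ (Fin n)

/-- `C₀^∞(ℝⁿ)`: complex-valued smooth functions with compact support, with the usual LF topology. -/
abbrev Test (n : ℕ) : Type := 𝓓((⊤ : Opens (Rn n)), ℂ)

/-- `𝓓'(ℝⁿ)`: continuous complex-linear forms on `C₀^∞(ℝⁿ)`. -/
abbrev Distr (n : ℕ) : Type := Test n →L[ℂ] ℂ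

variable {n : ℕ}

/-- `⟨ξ⟩ = (1 + |ξ|²)^{1/2}`. -/
def bracket (ξ : Rn n) : ℝ := (1 + ‖ξ‖ ^ 2) ^ (1 / 2 : ℝ)

/-- `C, N` are positive constants that define the weight `k`:
`k(ξ + η) ≤ C ⟨ξ⟩^N k(η)` for all `ξ, η`. -/
def IsWeightBound (k : Rn n → ℝ) (C N : ℝ) : Prop :=
  0 < C ∧ 0 < N ∧ ∀ ξ η : Rn n, k (ξ + η) ≤ C * bracket ξ ^ N * k η

/-- The class `K_pol(ℝⁿ)` of weight functions of polynomial growth: positive (Lebesgue) measurable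
functions that admit constants as in `IsWeightBound`. -/
def IsPolWeight (k : Rn n → ℝ) : Prop :=
  AEMeasurable k volume ∧ (∀ ξ, 0 < k ξ) ∧ ∃ C N : ℝ, IsWeightBound k C N

/-! ### The Fourier transform, normalised by `û(ξ) = ∫ e^{-i⟨x,ξ⟩} u(x) dx` -/

/-- The dilation `x ↦ x / (2π)` of `ℝⁿ`. -/
def dilation : Rn n ≃L[ℝ] Rn n :=
  ContinuousLinearEquiv.smulLeft
    (Units.mk0 ((2 * Real.pi)⁻¹ : ℝ) (inv_ne_zero Real.two_pi_pos.ne'))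

/-- The Fourier transform on `𝓢(ℝⁿ)`: Mathlib's one, `∫ e^{-2πi⟨x,ξ⟩} φ(x) dx`, evaluated
at `ξ / (2π)`; see `hat_apply`. -/
def hat : 𝓢(Rn n, ℂ) →L[ℂ] 𝓢(Rn n, ℂ) :=
  (SchwartzMap.compCLMOfContinuousLinearEquiv ℂ dilation).comp
    (FourierTransform.fourierCLM ℂ 𝓢(Rn n, ℂ))

theorem hat_apply (φ : 𝓢(Rn n, ℂ)) (ξ : Rn n) :
    hat φ ξ = ∫ x, Complex.exp (-(Complex.I * (inner ℝ x ξ : ℝ))) * φ x := by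
  have h : hat φ ξ = 𝓕 (φ : Rn n → ℂ) ((2 * Real.pi)⁻¹ • ξ) := rfl
  rw [h, Real.fourier_eq']
  refine integral_congr_ae (Filter.Eventually.of_forall fun x => ?_)
  simp only [smul_eq_mul, inner_smul_right]
  congr 2
  have : (Real.pi : ℂ) ≠ 0 := by exact_mod_cast Real.pi_ne_zero
  push_cast
  field_simp

/-- The Fourier transform on `𝓢'(ℝⁿ)`: `⟨v̂, φ⟩ = ⟨v, φ̂⟩`. -/
def hatDist (v : 𝓢'(Rn n, ℂ)) : 𝓢'(Rn n, ℂ) :=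
  PointwiseConvergenceCLM.precomp ℂ hat v

/-- The tempered distribution `T` is (given by) the locally integrable function `g`. -/
def IsGivenBy (T : 𝓢'(Rn n, ℂ)) (g : Rn n → ℂ) : Prop :=
  LocallyIntegrable g volume ∧
    ∀ φ : 𝓢(Rn n, ℂ), HasCompactSupport φ → T φ = ∫ ξ, g ξ * φ ξ

/-- The norm `‖v‖_{q,k} = ‖k v̂‖_{L^q}` of the space `B_{q,k}(ℝⁿ)`, for arbitrary `v ∈ 𝓢'(ℝⁿ)`;
it is `∞` if `v̂` is not a function. (The function `v̂` is unique up to null sets.) -/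
def bNorm (q : ℝ≥0∞) (k : Rn n → ℝ) (v : 𝓢'(Rn n, ℂ)) : ℝ≥0∞ :=
  ⨅ (g : Rn n → ℂ) (_ : IsGivenBy (hatDist v) g), eLpNorm (fun ξ => (k ξ : ℂ) * g ξ) q volume

/-- The norm of the Hilbert space `𝓑_k(ℝⁿ) = B_{2,k}(ℝⁿ)`. -/
def calBNorm (k : Rn n → ℝ) (v : 𝓢'(Rn n, ℂ)) : ℝ≥0∞ := bNorm 2 k v

/-! ### Operations on test functions and distributions -/

/-- The translate `τ_y χ = χ(· - y)`. -/
def translateTest (y : Rn n) (χ : Test n) : Test n where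
  toFun x := χ (x - y)
  contDiff' := χ.contDiff.comp (contDiff_id.sub contDiff_const)
  hasCompactSupport' := χ.hasCompactSupport.comp_homeomorph (Homeomorph.subRight y)
  tsupport_subset' := Set.subset_univ _

/-- The test function `x ↦ e^{-i⟨x,ξ⟩} χ(x)`. -/
def modulate (ξ : Rn n) (χ : Test n) : Test n where
  toFun x := Complex.exp (-(Complex.I * (inner ℝ x ξ : ℝ))) * χ x
  contDiff' := by
    refine ContDiff.mul ?_ χ.contDiff
    refine ContDiff.cexp (ContDiff.neg (contDiff_const.mul ?_))
    exact Complex.ofRealCLM.contDiff.comp (contDiff_id.inner ℝ contDiff_const)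
  hasCompactSupport' := χ.hasCompactSupport.mul_left
  tsupport_subset' := Set.subset_univ _

/-- The support of a test function as a bundled compact set. -/
def testSupport (χ : Test n) : Compacts (Rn n) := ⟨tsupport χ, χ.hasCompactSupport⟩

/-- Multiplication by a test function `χ`, from `𝓢(ℝⁿ)` to the smooth functions supported in
`supp χ`. -/
def mulTestLM (χ : Test n) : 𝓢(Rn n, ℂ) →ₗ[ℂ] 𝓓_{testSupport χ}(Rn n, ℂ) where
  toFun φ := ContDiffMapSupportedIn.of_support_subset (f := fun x => χ x * φ x)
    (χ.contDiff.mul (φ.smooth ⊤))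
    ((Function.support_mul_subset_left _ _).trans (subset_tsupport _))
  map_add' φ ψ := by
    ext x
    exact mul_add _ _ _
  map_smul' c φ := by
    ext x
    exact mul_left_comm _ _ _

theorem continuous_mulTestLM (χ : Test n) : Continuous (mulTestLM χ) := by
  have hχ : Function.HasTemperateGrowth (χ : Rn n → ℂ) :=
    χ.hasCompactSupport.hasTemperateGrowth χ.contDiff
  refine WithSeminorms.continuous_of_continuous_comp
    (ContDiffMapSupportedIn.withSeminorms ℂ (Rn n) ℂ ⊤ (testSupport χ)) _ fun i => ?_
  have hc : Continuous ((SchwartzMap.seminorm ℂ 0 i).comp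
      (SchwartzMap.smulLeftCLM ℂ (χ : Rn n → ℂ)).toLinearMap : Seminorm ℂ 𝓢(Rn n, ℂ)) :=
    ((schwartz_withSeminorms ℂ (Rn n) ℂ).continuous_seminorm (0, i)).comp
      (SchwartzMap.smulLeftCLM ℂ (χ : Rn n → ℂ)).continuous
  refine Seminorm.continuous_of_le hc fun φ => ?_
  refine (ContDiffMapSupportedIn.seminorm_top_le_iff ℂ (apply_nonneg _ _) i _).2 fun x hx => ?_
  have h := SchwartzMap.norm_iteratedFDeriv_le_seminorm ℂ
    (SchwartzMap.smulLeftCLM ℂ (χ : Rn n → ℂ) φ) i x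
  have he : ((SchwartzMap.smulLeftCLM ℂ (χ : Rn n → ℂ) φ : 𝓢(Rn n, ℂ)) : Rn n → ℂ) =
      mulTestLM χ φ := by
    ext x
    exact SchwartzMap.smulLeftCLM_apply_apply hχ φ x
  rw [he] at h
  exact h

/-- The product `u χ`, as a tempered distribution: `⟨u χ, φ⟩ = ⟨u, χ φ⟩`. -/
def mulTest (u : Distr n) (χ : Test n) : 𝓢'(Rn n, ℂ) :=
  ContinuousLinearMap.toPointwiseConvergenceCLM ℂ (RingHom.id ℂ) 𝓢(Rn n, ℂ) ℂ
    ((u.comp (TestFunction.ofSupportedInCLM ℂ (Set.subset_univ _))).comp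
      (⟨mulTestLM χ, continuous_mulTestLM χ⟩ : 𝓢(Rn n, ℂ) →L[ℂ] 𝓓_{testSupport χ}(Rn n, ℂ)))

/-! ### The spaces `𝓑_k^p(ℝⁿ)` and `S_w^p(ℝⁿ)` -/

/-- `(∫ f(y)^p dy)^{1/p}` if `p < ∞`, and `sup_y f(y)` if `p = ∞`. -/
def mixedNorm (p : ℝ≥0∞) (f : Rn n → ℝ≥0∞) : ℝ≥0∞ :=
  if p = ∞ then ⨆ y, f y else (∫⁻ y, f y ^ p.toReal) ^ (1 / p.toReal)

/-- The function `y ↦ ‖u τ_y χ‖_{𝓑_k}`. -/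
def localNorm (k : Rn n → ℝ) (u : Distr n) (χ : Test n) (y : Rn n) : ℝ≥0∞ :=
  calBNorm k (mulTest u (translateTest y χ))

/-- `u ∈ 𝓑_k^p(ℝⁿ)`: there is `χ ∈ C₀^∞ ∖ 0` such that `y ↦ ‖u τ_y χ‖_{𝓑_k}` belongs to `L^p`. -/
def MemB (k : Rn n → ℝ) (p : ℝ≥0∞) (u : Distr n) : Prop :=
  ∃ χ : Test n, χ ≠ 0 ∧ MemLp (localNorm k u χ) p volume

/-- The norm `‖u‖_{k,p,χ}`. -/
def normB (k : Rn n → ℝ) (p : ℝ≥0∞) (χ : Test n) (u : Distr n) : ℝ≥0∞ :=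
  mixedNorm p (localNorm k u χ)

/-- The function `U_{χ,p}(ξ)`, the `L^p` norm in `y` of
`(u τ_y χ)^(ξ) = ⟨u, e^{-i⟨·,ξ⟩} χ(· - y)⟩`. -/
def bigU (p : ℝ≥0∞) (u : Distr n) (χ : Test n) (ξ : Rn n) : ℝ≥0∞ :=
  mixedNorm p fun y => ‖u (modulate ξ (translateTest y χ))‖ₑ

/-- `u ∈ S_w^p(ℝⁿ)`: there is `χ ∈ C₀^∞ ∖ 0` such that `U_{χ,p}` belongs to `L¹`. -/
def MemSw (p : ℝ≥0∞) (u : Distr n) : Prop :=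
  ∃ χ : Test n, χ ≠ 0 ∧ MemLp (bigU p u χ) 1 volume

/-- The norm `‖u‖_{S_w^p,χ} = ‖U_{χ,p}‖_{L¹}`. -/
def normSw (p : ℝ≥0∞) (χ : Test n) (u : Distr n) : ℝ≥0∞ := ∫⁻ ξ, bigU p u χ ξ

/-- The Sobolev norm `‖χ‖_{H^s} = ‖⟨·⟩^s χ̂‖_{L²}` of a test function. -/
def sobolevNorm (s : ℝ) (χ : Test n) : ℝ≥0∞ :=
  eLpNorm (fun ξ : Rn n => ((bracket ξ ^ s : ℝ) : ℂ) * ∫ x, modulate ξ χ x) 2 volume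

end KatoSobolev

end

open KatoSobolev

/-!
If `χ̃ = 1` on `supp χ`, then `u τ_yχ = (u τ_yχ̃)(τ_yχ)`, so the Fourier transform of `u τ_yχ` is
`(2π)^{-n}` times the convolution of the Fourier transforms of `u τ_yχ̃` and `τ_yχ`. The weight
condition `k(ξ) ≤ C ⟨ξ - η⟩^N k(η)` and the Cauchy–Schwarz inequality give, for all `y` and `ξ`,
`k(ξ) |(u τ_yχ)^(ξ)| ≤ (2π)^{-n} C ‖χ‖_{H^N} ‖u τ_yχ̃‖_{𝓑_k}`.
It remains to take `L^p` norms in `y`, divide by `k(ξ)` and integrate over `ξ`.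

For arbitrary `χ` and `χ̃ ≠ 0`, finitely many translates of `χ̃` have no common zero on `supp χ`,
so `χ = ∑ φ_a τ_aχ̃` with `φ_a = χ conj(τ_aχ̃) / ∑ |τ_bχ̃|²`. The estimate applies to each
summand, and the quasi-triangle inequality in `L^p` adds them up.
-/

noncomputable section

open Filter Topology
open scoped NNReal ContDiff Pointwise

namespace KatoSobolev

/-! ### Cutoffs in the Schwartz space -/

section Cutoff

variable {𝕜 E F : Type*} [NontriviallyNormedField 𝕜] [NormedAddCommGroup E]
  [NormedAddCommGroup F]

theorem norm_iteratedFDeriv_comp_const_smul_le [NormedSpace 𝕜 E] [NormedSpace 𝕜 F] {f : E → F}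
    {i : ℕ} (hf : ContDiff 𝕜 i f) {r : 𝕜} (hr : ‖r‖ ≤ 1) (x : E) :
    ‖iteratedFDeriv 𝕜 i (fun z => f (r • z)) x‖ ≤ ‖iteratedFDeriv 𝕜 i f (r • x)‖ := by
  rw [congrFun (iteratedFDeriv_comp_const_smul r hf) x, norm_smul, norm_pow]
  exact mul_le_of_le_one_left (norm_nonneg _) (pow_le_one₀ (norm_nonneg r) hr)

variable [NormedSpace ℝ E] [NormedSpace ℝ F]

theorem exists_norm_iteratedFDeriv_const_sub_le {f : E → F} (hf : ContDiff ℝ ∞ f)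
    (hfc : HasCompactSupport f) (c : F) (i : ℕ) :
    ∃ M, ∀ x, ‖iteratedFDeriv ℝ i (fun x => c - f x) x‖ ≤ M := by
  have hi : (i : WithTop ℕ∞) ≤ (∞ : WithTop ℕ∞) := by exact_mod_cast le_top
  obtain ⟨M, hM⟩ :=
    (hfc.iteratedFDeriv (𝕜 := ℝ) i).exists_bound_of_continuous (hf.continuous_iteratedFDeriv hi)
  refine ⟨‖c‖ + M, fun x => ?_⟩
  rw [fun_iteratedFDeriv_sub_apply contDiff_const.contDiffAt (hf.of_le hi).contDiffAt]
  refine (norm_sub_le _ _).trans (add_le_add ?_ (hM x))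
  rcases eq_or_ne i 0 with rfl | hi0
  · simp
  · simp [iteratedFDeriv_const_of_ne hi0]

theorem exists_cutoff_seq [FiniteDimensional ℝ E] :
    ∃ (β : ℕ → E → ℝ) (M : ℕ → ℝ), (∀ m, ContDiff ℝ ∞ (β m)) ∧ (∀ m, HasCompactSupport (β m)) ∧
      (∀ m x, ‖β m x‖ ≤ 1) ∧ (∀ m : ℕ, ∀ x ∈ Metric.ball 0 ((m : ℝ) + 1), β m x = 1) ∧
      ∀ m i x, ‖iteratedFDeriv ℝ i (fun x => 1 - β m x) x‖ ≤ M i := by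
  let b : ContDiffBump (0 : E) := ⟨1, 2, one_pos, one_lt_two⟩
  let r : ℕ → ℝ := fun m => ((m : ℝ) + 1)⁻¹
  have hr_pos : ∀ m, 0 < r m := fun m => by positivity
  have hr_le : ∀ m, ‖r m‖ ≤ 1 := fun m => by
    rw [Real.norm_of_nonneg (hr_pos m).le]
    exact inv_le_one_of_one_le₀ (by simp)
  choose M hM using exists_norm_iteratedFDeriv_const_sub_le b.contDiff b.hasCompactSupport (1 : ℝ)
  refine ⟨fun m x => b (r m • x), M, fun m => b.contDiff.comp (contDiff_const_smul (r m)),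
    fun m => b.hasCompactSupport.comp_homeomorph (Homeomorph.smulOfNeZero (r m) (hr_pos m).ne'),
    fun m x => ?_, fun m x hx => b.one_of_mem_closedBall ?_, fun m i x => ?_⟩
  · rw [Real.norm_of_nonneg b.nonneg]
    exact b.le_one
  · have hx_le : ‖x‖ ≤ (m : ℝ) + 1 := (mem_ball_zero_iff.1 hx).le
    rw [mem_closedBall_zero_iff, norm_smul, Real.norm_of_nonneg (hr_pos m).le]
    exact inv_mul_le_one_of_le₀ hx_le (by positivity)
  · exact (norm_iteratedFDeriv_comp_const_smul_le (contDiff_const.sub b.contDiff) (hr_le m) x).trans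
      (hM i _)

/-- Where `g` does not vanish, `1 ≤ R⁻¹ * ‖x‖`; this trades one more power of `‖x‖` for `R⁻¹`. -/
theorem seminorm_smulLeftCLM_le_of_eq_zero_on_ball {g : E → ℝ} (hg : g.HasTemperateGrowth) {R : ℝ}
    (hR : 0 < R) (hg_zero : ∀ x ∈ Metric.ball 0 R, g x = 0) {M : ℕ → ℝ}
    (hM : ∀ i x, ‖iteratedFDeriv ℝ i g x‖ ≤ M i) (j l : ℕ) (θ : 𝓢(E, F)) :
    SchwartzMap.seminorm ℝ j l (SchwartzMap.smulLeftCLM F g θ) ≤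
      R⁻¹ * ∑ i ∈ Finset.range (l + 1),
        (l.choose i : ℝ) * M i * SchwartzMap.seminorm ℝ (j + 1) (l - i) θ := by
  have hM_nonneg : ∀ i, 0 ≤ M i := fun i => (norm_nonneg _).trans (hM i 0)
  have hsum_nonneg : 0 ≤ R⁻¹ * ∑ i ∈ Finset.range (l + 1),
      (l.choose i : ℝ) * M i * SchwartzMap.seminorm ℝ (j + 1) (l - i) θ :=
    mul_nonneg (inv_nonneg.2 hR.le) (Finset.sum_nonneg fun i _ =>
      mul_nonneg (mul_nonneg (Nat.cast_nonneg _) (hM_nonneg i)) (apply_nonneg _ _))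
  refine SchwartzMap.seminorm_le_bound ℝ j l _ hsum_nonneg fun x => ?_
  rw [SchwartzMap.smulLeftCLM_apply hg]
  by_cases hx : x ∈ Metric.ball 0 R
  · have hlocal : (fun x => g x • θ x) =ᶠ[𝓝 x] fun _ => 0 := by
      filter_upwards [Metric.isOpen_ball.mem_nhds hx] with z hz
      rw [hg_zero z hz, zero_smul]
    rw [(hlocal.iteratedFDeriv ℝ l).eq_of_nhds]
    simpa using hsum_nonneg
  · have hx_ge : 1 ≤ R⁻¹ * ‖x‖ := by
      rw [inv_mul_eq_div, one_le_div hR]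
      simpa using hx
    have hterm : ∀ i, ‖x‖ ^ j * ‖iteratedFDeriv ℝ (l - i) θ x‖ ≤
        R⁻¹ * SchwartzMap.seminorm ℝ (j + 1) (l - i) θ := fun i =>
      calc ‖x‖ ^ j * ‖iteratedFDeriv ℝ (l - i) θ x‖
        _ ≤ (R⁻¹ * ‖x‖) * (‖x‖ ^ j * ‖iteratedFDeriv ℝ (l - i) θ x‖) :=
          le_mul_of_one_le_left (by positivity) hx_ge
        _ = R⁻¹ * (‖x‖ ^ (j + 1) * ‖iteratedFDeriv ℝ (l - i) θ x‖) := by ring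
        _ ≤ _ := by gcongr; exact SchwartzMap.le_seminorm ℝ (j + 1) (l - i) θ x
    calc ‖x‖ ^ j * ‖iteratedFDeriv ℝ l (fun x => g x • θ x) x‖
      _ ≤ ‖x‖ ^ j * ∑ i ∈ Finset.range (l + 1),
          (l.choose i : ℝ) * ‖iteratedFDeriv ℝ i g x‖ * ‖iteratedFDeriv ℝ (l - i) θ x‖ := by
        gcongr
        exact norm_iteratedFDeriv_smul_le hg.1 (θ.smooth ⊤) x (by exact_mod_cast le_top)
      _ = ∑ i ∈ Finset.range (l + 1), (l.choose i : ℝ) * ‖iteratedFDeriv ℝ i g x‖ *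
          (‖x‖ ^ j * ‖iteratedFDeriv ℝ (l - i) θ x‖) := by
        rw [Finset.mul_sum]
        exact Finset.sum_congr rfl fun i _ => by ring
      _ ≤ ∑ i ∈ Finset.range (l + 1), (l.choose i : ℝ) * M i *
          (R⁻¹ * SchwartzMap.seminorm ℝ (j + 1) (l - i) θ) :=
        Finset.sum_le_sum fun i _ =>
          mul_le_mul (mul_le_mul_of_nonneg_left (hM i x) (Nat.cast_nonneg _)) (hterm i)
            (by positivity) (mul_nonneg (Nat.cast_nonneg _) (hM_nonneg i))
      _ = _ := by
        rw [Finset.mul_sum]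
        exact Finset.sum_congr rfl fun i _ => by ring

theorem exists_tendsto_hasCompactSupport [FiniteDimensional ℝ E] (θ : 𝓢(E, F)) :
    ∃ f : ℕ → 𝓢(E, F), (∀ m, HasCompactSupport (f m)) ∧ (∀ m x, ‖f m x‖ ≤ ‖θ x‖) ∧
      Tendsto f atTop (𝓝 θ) := by
  obtain ⟨β, M, hβ, hβc, hβ_le, hβ_one, hM⟩ := exists_cutoff_seq (E := E)
  have hβT : ∀ m, (β m).HasTemperateGrowth := fun m => (hβc m).hasTemperateGrowth (hβ m)
  have hγT : ∀ m, (fun x => 1 - β m x).HasTemperateGrowth := fun m =>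
    (Function.HasTemperateGrowth.const 1).sub (hβT m)
  refine ⟨fun m => SchwartzMap.smulLeftCLM F (β m) θ, fun m => ?_, fun m x => ?_, ?_⟩
  · rw [SchwartzMap.smulLeftCLM_apply (hβT m)]
    exact (hβc m).smul_right
  · rw [SchwartzMap.smulLeftCLM_apply_apply (hβT m), norm_smul]
    exact mul_le_of_le_one_left (norm_nonneg _) (hβ_le m x)
  · rw [(schwartz_withSeminorms ℝ E F).tendsto_nhds]
    rintro ⟨j, l⟩ ε hε
    set A : ℝ := ∑ i ∈ Finset.range (l + 1),
      (l.choose i : ℝ) * M i * SchwartzMap.seminorm ℝ (j + 1) (l - i) θ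
    have hsub : ∀ m, θ - SchwartzMap.smulLeftCLM F (β m) θ =
        SchwartzMap.smulLeftCLM F (fun x => 1 - β m x) θ := fun m => by
      ext x
      simp [SchwartzMap.smulLeftCLM_apply_apply, hβT m, hγT m, sub_smul]
    have hbound : ∀ m : ℕ, SchwartzMap.seminorm ℝ j l
        (SchwartzMap.smulLeftCLM F (β m) θ - θ) ≤ ((m : ℝ) + 1)⁻¹ * A := fun m => by
      rw [map_sub_rev, hsub]
      exact seminorm_smulLeftCLM_le_of_eq_zero_on_ball (hγT m) (by positivity)
        (fun x hx => sub_eq_zero.2 (hβ_one m x hx).symm) (hM m) j l θ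
    have hlim : Tendsto (fun m : ℕ => ((m : ℝ) + 1)⁻¹ * A) atTop (𝓝 0) := by
      simpa using (tendsto_one_div_add_atTop_nhds_zero_nat (𝕜 := ℝ)).mul_const A
    filter_upwards [hlim.eventually_lt_const hε] with m hm
    exact (hbound m).trans_lt hm

end Cutoff

theorem IsGivenBy.enorm_apply_le {n : ℕ} {T : 𝓢'(Rn n, ℂ)} {g : Rn n → ℂ} (h : IsGivenBy T g)
    (θ : 𝓢(Rn n, ℂ)) : ‖T θ‖ₑ ≤ ∫⁻ ξ, ‖g ξ‖ₑ * ‖θ ξ‖ₑ := by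
  obtain ⟨f, hf_supp, hf_le, hf_lim⟩ := exists_tendsto_hasCompactSupport θ
  have hT : Tendsto (fun m => ‖T (f m)‖ₑ) atTop (𝓝 ‖T θ‖ₑ) :=
    (((map_continuous T).tendsto θ).comp hf_lim).enorm
  refine le_of_tendsto' hT fun m => ?_
  calc ‖T (f m)‖ₑ
    _ = ‖∫ ξ, g ξ * f m ξ‖ₑ := by rw [h.2 _ (hf_supp m)]
    _ ≤ ∫⁻ ξ, ‖g ξ * f m ξ‖ₑ := enorm_integral_le_lintegral_enorm _
    _ ≤ ∫⁻ ξ, ‖g ξ‖ₑ * ‖θ ξ‖ₑ := lintegral_mono fun ξ => by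
      rw [enorm_mul]
      gcongr
      exact enorm_le_iff_norm_le.2 (hf_le m ξ)

/-! ### The Fourier transform of test functions -/

section Fourier

variable {n : ℕ}

/-- The inclusion `C₀^∞(ℝⁿ) ⊂ 𝓢(ℝⁿ)`, in which Fourier transforms are taken. -/
def testToSchwartz (χ : Test n) : 𝓢(Rn n, ℂ) := χ.hasCompactSupport.toSchwartzMap χ.contDiff

@[simp]
theorem testToSchwartz_apply (χ : Test n) (x : Rn n) : testToSchwartz χ x = χ x := rfl

theorem testToSchwartz_injective : Function.Injective (testToSchwartz (n := n)) := fun _ _ h =>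
  TestFunction.ext fun x => DFunLike.congr_fun h x

theorem modulate_apply (ξ : Rn n) (χ : Test n) (x : Rn n) :
    modulate ξ χ x = Complex.exp (-(Complex.I * (inner ℝ x ξ : ℝ))) * χ x := rfl

@[simp]
theorem translateTest_apply (y : Rn n) (χ : Test n) (x : Rn n) :
    translateTest y χ x = χ (x - y) := rfl

theorem hat_testToSchwartz (χ : Test n) (ξ : Rn n) :
    hat (testToSchwartz χ) ξ = ∫ x, modulate ξ χ x := hat_apply _ _

theorem dilation_symm_apply (x : Rn n) : dilation.symm x = (2 * Real.pi) • x := by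
  rw [ContinuousLinearEquiv.symm_apply_eq]
  exact (inv_smul_smul₀ Real.two_pi_pos.ne' x).symm

/-- The inverse Fourier transform on `𝓢(ℝⁿ)`, in the normalisation inverse to that of `hat`. -/
def invHat (φ : 𝓢(Rn n, ℂ)) : 𝓢(Rn n, ℂ) :=
  𝓕⁻ (SchwartzMap.compCLMOfContinuousLinearEquiv ℂ dilation.symm φ)

theorem hat_invHat (φ : 𝓢(Rn n, ℂ)) : hat (invHat φ) = φ := by
  ext x
  simp [hat, invHat]

theorem invHat_hat (φ : 𝓢(Rn n, ℂ)) : invHat (hat φ) = φ := by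
  have h : SchwartzMap.compCLMOfContinuousLinearEquiv ℂ dilation.symm (hat φ) = 𝓕 φ := by
    ext x
    simp [hat]
  simp [invHat, h]

theorem invHat_apply (φ : 𝓢(Rn n, ℂ)) (η : Rn n) :
    invHat φ η = ((2 * Real.pi) ^ (-(n : ℝ)) : ℝ) *
      ∫ x, Complex.exp (Complex.I * (inner ℝ x η : ℝ)) * φ x := by
  have hscale := Measure.integral_comp_smul_of_nonneg (volume : Measure (Rn n))
    (fun x => Complex.exp (Complex.I * (inner ℝ x η : ℝ)) * φ x) (2 * Real.pi)
    (hR := Real.two_pi_pos.le)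
  rw [finrank_euclideanSpace_fin] at hscale
  rw [invHat, SchwartzMap.fourierInv_coe, Real.fourierInv_eq', Real.rpow_neg Real.two_pi_pos.le,
    Real.rpow_natCast, ← Complex.real_smul, ← hscale]
  refine integral_congr_ae (Eventually.of_forall fun x => ?_)
  simp only [SchwartzMap.compCLMOfContinuousLinearEquiv_apply, Function.comp_apply,
    dilation_symm_apply, smul_eq_mul, real_inner_smul_left]
  congr 2
  push_cast
  ring

theorem invHat_testToSchwartz_modulate (ξ η : Rn n) (ψ : Test n) :
    invHat (testToSchwartz (modulate ξ ψ)) η =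
      ((2 * Real.pi) ^ (-(n : ℝ)) : ℝ) * ∫ x, modulate (ξ - η) ψ x := by
  rw [invHat_apply]
  congr 2 with x
  rw [testToSchwartz_apply, modulate_apply, modulate_apply, ← mul_assoc, ← Complex.exp_add,
    inner_sub_right]
  congr 2
  push_cast
  ring

theorem integral_modulate_translateTest (ξ y : Rn n) (χ : Test n) :
    ∫ x, modulate ξ (translateTest y χ) x =
      Complex.exp (-(Complex.I * (inner ℝ y ξ : ℝ))) * ∫ x, modulate ξ χ x := by
  rw [← integral_add_right_eq_self _ y, ← integral_const_mul]
  congr 1 with x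
  simp only [modulate_apply, translateTest_apply, add_sub_cancel_right, inner_add_left,
    ← mul_assoc, ← Complex.exp_add]
  push_cast
  ring_nf

theorem enorm_integral_modulate_translateTest (ξ y : Rn n) (χ : Test n) :
    ‖∫ x, modulate ξ (translateTest y χ) x‖ₑ = ‖∫ x, modulate ξ χ x‖ₑ := by
  refine enorm_eq_iff_norm_eq.2 ?_
  simp [integral_modulate_translateTest, Complex.norm_exp]

end Fourier

/-! ### The Sobolev norm -/

section Sobolev

variable {n : ℕ}

theorem bracket_pos (ξ : Rn n) : 0 < bracket ξ := Real.rpow_pos_of_pos (by positivity) _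

theorem bracket_rpow (ξ : Rn n) (s : ℝ) : bracket ξ ^ s = (1 + ‖ξ‖ ^ 2) ^ (s / 2) := by
  rw [bracket, ← Real.rpow_mul (by positivity), one_div_mul_eq_div]

/-- The function `⟨·⟩^s χ̂`, whose `L²` norm is the Sobolev norm of `χ`, as a Schwartz
function. -/
def sobolevWeighted (s : ℝ) (χ : Test n) : 𝓢(Rn n, ℂ) :=
  SchwartzMap.smulLeftCLM ℂ (fun ξ : Rn n => bracket ξ ^ s) (hat (testToSchwartz χ))

theorem sobolevWeighted_apply (s : ℝ) (χ : Test n) (ξ : Rn n) :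
    sobolevWeighted s χ ξ = ((bracket ξ ^ s : ℝ) : ℂ) * ∫ x, modulate ξ χ x := by
  have hbracket : Function.HasTemperateGrowth fun ξ : Rn n => bracket ξ ^ s := by
    simpa only [bracket_rpow] using Function.hasTemperateGrowth_one_add_norm_sq_rpow (Rn n) (s / 2)
  rw [sobolevWeighted, SchwartzMap.smulLeftCLM_apply_apply hbracket, hat_testToSchwartz,
    Complex.real_smul]

theorem eLpNorm_sobolevWeighted (s : ℝ) (χ : Test n) :
    eLpNorm (sobolevWeighted s χ) 2 volume = sobolevNorm s χ := by
  rw [sobolevNorm, funext (sobolevWeighted_apply s χ)]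

theorem sobolevNorm_ne_top (s : ℝ) (χ : Test n) : sobolevNorm s χ ≠ ⊤ := by
  rw [← eLpNorm_sobolevWeighted]
  exact ((sobolevWeighted s χ).memLp 2 volume).eLpNorm_ne_top

theorem eq_zero_of_sobolevNorm_eq_zero {s : ℝ} {χ : Test n} (h : sobolevNorm s χ = 0) : χ = 0 := by
  have hcont := (sobolevWeighted s χ).continuous
  rw [← eLpNorm_sobolevWeighted, eLpNorm_eq_zero_iff hcont.aestronglyMeasurable two_ne_zero,
    hcont.ae_eq_iff_eq volume continuous_zero] at h
  have hhat : hat (testToSchwartz χ) = hat (testToSchwartz 0) := by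
    ext ξ
    have hξ := congrFun h ξ
    rw [sobolevWeighted_apply, Pi.zero_apply, mul_eq_zero, Complex.ofReal_eq_zero] at hξ
    rw [hat_testToSchwartz, hξ.resolve_left (Real.rpow_pos_of_pos (bracket_pos ξ) s).ne']
    simp [hat_testToSchwartz, modulate_apply]
  exact testToSchwartz_injective (Function.LeftInverse.injective invHat_hat hhat)

end Sobolev

/-! ### The pointwise estimate -/

theorem lintegral_enorm_mul_enorm_le {α E F : Type*} {m : MeasurableSpace α} {μ : Measure α}
    [NormedAddCommGroup E] [NormedAddCommGroup F] {f : α → E} {g : α → F}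
    (hf : AEStronglyMeasurable f μ) (hg : AEStronglyMeasurable g μ) :
    ∫⁻ x, ‖f x‖ₑ * ‖g x‖ₑ ∂μ ≤ eLpNorm f 2 μ * eLpNorm g 2 μ := by
  have h := eLpNorm_le_eLpNorm_mul_eLpNorm_of_nnnorm (p := 2) (q := 2) (r := 1) hf hg
    (fun x y => ‖x‖ * ‖y‖) 1 (Eventually.of_forall fun x => by simp)
  simpa [eLpNorm_one_eq_lintegral_enorm, enorm_mul] using h

section Pointwise

variable {n : ℕ}

/-- The product of two test functions. -/
def testMul (φ χ : Test n) : Test n where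
  toFun x := φ x * χ x
  contDiff' := φ.contDiff.mul χ.contDiff
  hasCompactSupport' := φ.hasCompactSupport.mul_right
  tsupport_subset' := Set.subset_univ _

@[simp]
theorem testMul_apply (φ χ : Test n) (x : Rn n) : testMul φ χ x = φ x * χ x := rfl

theorem modulate_translateTest_testMul (ξ y : Rn n) (φ χ : Test n) :
    modulate ξ (translateTest y (testMul φ χ)) =
      testMul (modulate ξ (translateTest y φ)) (translateTest y χ) :=
  TestFunction.ext fun _ => (mul_assoc _ _ _).symm

theorem mulTest_testToSchwartz (u : Distr n) (χ φ : Test n) :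
    mulTest u χ (testToSchwartz φ) = u (testMul φ χ) :=
  congrArg u (TestFunction.ext fun _ => mul_comm _ _)

/-- The Fourier transform `(u τ_y χ)^(ξ)`, viewed for fixed `ξ` as a function of the position `y`
of the window: this is the order in which `bigU` takes norms. -/
def localFourier (u : Distr n) (χ : Test n) (ξ y : Rn n) : ℂ := u (modulate ξ (translateTest y χ))

theorem localFourier_testMul (u : Distr n) (φ χ : Test n) (ξ y : Rn n) :
    localFourier u (testMul φ χ) ξ y =
      hatDist (mulTest u (translateTest y χ))
        (invHat (testToSchwartz (modulate ξ (translateTest y φ)))) := by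
  rw [localFourier, modulate_translateTest_testMul, ← mulTest_testToSchwartz]
  exact congrArg (mulTest u (translateTest y χ)) (hat_invHat _).symm

/-- The constant `(2π)^{-n} C ‖φ‖_{H^N}` of the theorem. -/
def windowConst (C N : ℝ) (φ : Test n) : ℝ≥0∞ :=
  ENNReal.ofReal ((2 * Real.pi) ^ (-(n : ℝ)) * C) * sobolevNorm N φ

theorem windowConst_ne_top (C N : ℝ) (φ : Test n) : windowConst C N φ ≠ ⊤ :=
  ENNReal.mul_ne_top ENNReal.ofReal_ne_top (sobolevNorm_ne_top N φ)

theorem windowConst_ne_zero {C : ℝ} (hC : 0 < C) (N : ℝ) {φ : Test n} (hφ : φ ≠ 0) :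
    windowConst C N φ ≠ 0 :=
  mul_ne_zero
    (ENNReal.ofReal_pos.2 (mul_pos (Real.rpow_pos_of_pos Real.two_pi_pos _) hC)).ne'
    (mt eq_zero_of_sobolevNorm_eq_zero hφ)

theorem IsWeightBound.one_le_ofReal_mul_enorm {k : Rn n → ℝ} {C N : ℝ} (hCN : IsWeightBound k C N)
    (hk_pos : ∀ ξ, 0 < k ξ) (ξ η : Rn n) :
    1 ≤ ENNReal.ofReal C * ENNReal.ofReal (1 / k ξ) *
      (‖(k η : ℂ)‖ₑ * ‖((bracket (ξ - η) ^ N : ℝ) : ℂ)‖ₑ) := by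
  have hC := hCN.1.le
  have hb := (Real.rpow_pos_of_pos (bracket_pos (ξ - η)) N).le
  have hinv := (one_div_pos.2 (hk_pos ξ)).le
  have h := hCN.2.2 (ξ - η) η
  rw [sub_add_cancel] at h
  simp only [← ofReal_norm, Complex.norm_real, Real.norm_of_nonneg hb,
    Real.norm_of_nonneg (hk_pos η).le]
  rw [← ENNReal.ofReal_mul hC, ← ENNReal.ofReal_mul (hk_pos η).le,
    ← ENNReal.ofReal_mul (mul_nonneg hC hinv), ENNReal.one_le_ofReal]
  calc (1 : ℝ) ≤ C * bracket (ξ - η) ^ N * k η / k ξ := (one_le_div (hk_pos ξ)).2 h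
    _ = C * (1 / k ξ) * (k η * bracket (ξ - η) ^ N) := by ring

theorem IsWeightBound.enorm_invHat_modulate_le {k : Rn n → ℝ} {C N : ℝ}
    (hCN : IsWeightBound k C N) (hk_pos : ∀ ξ, 0 < k ξ) (φ : Test n) (ξ y η : Rn n) :
    ‖invHat (testToSchwartz (modulate ξ (translateTest y φ))) η‖ₑ ≤
      ENNReal.ofReal ((2 * Real.pi) ^ (-(n : ℝ)) * C) * ENNReal.ofReal (1 / k ξ) *
        (‖(k η : ℂ)‖ₑ * ‖sobolevWeighted N φ (ξ - η)‖ₑ) := by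
  have hpi : (0 : ℝ) ≤ (2 * Real.pi) ^ (-(n : ℝ)) := Real.rpow_nonneg Real.two_pi_pos.le _
  rw [invHat_testToSchwartz_modulate, enorm_mul, enorm_integral_modulate_translateTest,
    sobolevWeighted_apply, enorm_mul, ENNReal.ofReal_mul hpi, ← ofReal_norm (_ : ℂ),
    Complex.norm_real, Real.norm_of_nonneg hpi]
  calc _ ≤ ENNReal.ofReal C * ENNReal.ofReal (1 / k ξ) *
      (‖(k η : ℂ)‖ₑ * ‖((bracket (ξ - η) ^ N : ℝ) : ℂ)‖ₑ) *
        (ENNReal.ofReal ((2 * Real.pi) ^ (-(n : ℝ))) * ‖∫ x, modulate (ξ - η) φ x‖ₑ) :=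
      le_mul_of_one_le_left zero_le (hCN.one_le_ofReal_mul_enorm hk_pos ξ η)
    _ = _ := by ring

theorem IsGivenBy.enorm_invHat_modulate_le {k : Rn n → ℝ} (hk_meas : AEMeasurable k volume)
    (hk_pos : ∀ ξ, 0 < k ξ) {C N : ℝ} (hCN : IsWeightBound k C N) {T : 𝓢'(Rn n, ℂ)}
    {g : Rn n → ℂ} (hg : IsGivenBy T g) (φ : Test n) (ξ y : Rn n) :
    ‖T (invHat (testToSchwartz (modulate ξ (translateTest y φ))))‖ₑ ≤
      windowConst C N φ * ENNReal.ofReal (1 / k ξ) *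
        eLpNorm (fun η => (k η : ℂ) * g η) 2 volume := by
  set f := sobolevWeighted N φ
  set a := ENNReal.ofReal ((2 * Real.pi) ^ (-(n : ℝ)) * C) * ENNReal.ofReal (1 / k ξ) with ha
  have ha_top : a ≠ ⊤ := ENNReal.mul_ne_top ENNReal.ofReal_ne_top ENNReal.ofReal_ne_top
  have hkg : AEStronglyMeasurable (fun η => (k η : ℂ) * g η) volume :=
    (Complex.measurable_ofReal.comp_aemeasurable hk_meas).aestronglyMeasurable.mul
      hg.1.aestronglyMeasurable
  have hf_meas : AEStronglyMeasurable (fun η => f (ξ - η)) volume :=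
    (f.continuous.comp (continuous_const.sub continuous_id)).aestronglyMeasurable
  have hf_norm : eLpNorm (fun η => f (ξ - η)) 2 volume = sobolevNorm N φ :=
    (eLpNorm_comp_measurePreserving f.continuous.aestronglyMeasurable
      (Measure.measurePreserving_sub_left volume ξ)).trans (eLpNorm_sobolevWeighted N φ)
  calc ‖T (invHat (testToSchwartz (modulate ξ (translateTest y φ))))‖ₑ
    _ ≤ ∫⁻ η, ‖g η‖ₑ * ‖invHat (testToSchwartz (modulate ξ (translateTest y φ))) η‖ₑ :=
      hg.enorm_apply_le _
    _ ≤ ∫⁻ η, ‖g η‖ₑ * (a * (‖(k η : ℂ)‖ₑ * ‖f (ξ - η)‖ₑ)) := by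
      gcongr with η
      exact hCN.enorm_invHat_modulate_le hk_pos φ ξ y η
    _ = ∫⁻ η, a * (‖(k η : ℂ) * g η‖ₑ * ‖f (ξ - η)‖ₑ) := by
      congr 1 with η
      rw [enorm_mul]
      ring
    _ = a * ∫⁻ η, ‖(k η : ℂ) * g η‖ₑ * ‖f (ξ - η)‖ₑ := lintegral_const_mul' _ _ ha_top
    _ ≤ a * (eLpNorm (fun η => (k η : ℂ) * g η) 2 volume * sobolevNorm N φ) := by
      rw [← hf_norm]
      gcongr
      exact lintegral_enorm_mul_enorm_le hkg hf_meas
    _ = _ := by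
      rw [ha, windowConst]
      ring

theorem enorm_localFourier_testMul_le {k : Rn n → ℝ} (hk_meas : AEMeasurable k volume)
    (hk_pos : ∀ ξ, 0 < k ξ) {C N : ℝ} (hCN : IsWeightBound k C N) (u : Distr n) (φ χ : Test n)
    (ξ y : Rn n) :
    ‖localFourier u (testMul φ χ) ξ y‖ₑ ≤
      windowConst C N φ * ENNReal.ofReal (1 / k ξ) * localNorm k u χ y := by
  rcases eq_or_ne φ 0 with rfl | hφ
  · have hzero : modulate ξ (translateTest y (testMul 0 χ)) = 0 := by
      ext x
      simp [modulate_apply]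
    simp [localFourier, hzero]
  · have hA_ne_zero : windowConst C N φ * ENNReal.ofReal (1 / k ξ) ≠ 0 :=
      mul_ne_zero (windowConst_ne_zero hCN.1 N hφ)
        (ENNReal.ofReal_pos.2 (one_div_pos.2 (hk_pos ξ))).ne'
    have hA_ne_top : windowConst C N φ * ENNReal.ofReal (1 / k ξ) ≠ ⊤ :=
      ENNReal.mul_ne_top (windowConst_ne_top C N φ) ENNReal.ofReal_ne_top
    simp only [localFourier_testMul, localNorm, calBNorm, bNorm,
      ENNReal.mul_iInf_of_ne hA_ne_zero hA_ne_top]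
    exact le_iInf₂ fun g hg => hg.enorm_invHat_modulate_le hk_meas hk_pos hCN φ ξ y

theorem localNorm_translateTest (k : Rn n → ℝ) (u : Distr n) (a : Rn n) (χ : Test n) (y : Rn n) :
    localNorm k u (translateTest a χ) y = localNorm k u χ (y + a) := by
  have htrans : translateTest y (translateTest a χ) = translateTest (y + a) χ := by
    ext x
    simp [sub_sub]
  rw [localNorm, localNorm, htrans]

theorem eLpNorm_localNorm_translateTest (k : Rn n → ℝ) (p : ℝ≥0∞) (u : Distr n) (a : Rn n)
    (χ : Test n) :
    eLpNorm (localNorm k u (translateTest a χ)) p volume =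
      eLpNorm (localNorm k u χ) p volume := by
  conv_rhs => rw [← map_add_right_eq_self volume a]
  rw [(measurableEmbedding_addRight a).eLpNorm_map_measure,
    funext (localNorm_translateTest k u a χ), Function.comp_def]

end Pointwise

/-! ### Continuous families of test functions -/

section Families

theorem contDiff_iteratedFDeriv_of_uncurry {𝕜 P E F : Type*} [NontriviallyNormedField 𝕜]
    [NormedAddCommGroup P] [NormedSpace 𝕜 P] [NormedAddCommGroup E] [NormedSpace 𝕜 E]
    [NormedAddCommGroup F] [NormedSpace 𝕜 F] {f : P → E → F}
    (hf : ContDiff 𝕜 ∞ (Function.uncurry f)) (i : ℕ) :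
    ContDiff 𝕜 ∞ fun q : P × E => iteratedFDeriv 𝕜 i (f q.1) q.2 := by
  induction i with
  | zero =>
    simp only [iteratedFDeriv_zero_eq_comp, Function.comp_apply]
    exact (continuousMultilinearCurryFin0 𝕜 E F).symm.contDiff.comp hf
  | succ i ih =>
    simp only [iteratedFDeriv_succ_eq_comp_left, Function.comp_apply]
    have hfderiv : ContDiff 𝕜 ∞ fun q : P × E => fderiv 𝕜 (iteratedFDeriv 𝕜 i (f q.1)) q.2 :=
      ContDiff.fderiv (m := ∞) (f := fun q : P × E => iteratedFDeriv 𝕜 i (f q.1))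
        (ih.comp ((contDiff_fst.comp contDiff_fst).prodMk contDiff_snd)) contDiff_snd le_rfl
    exact (LinearIsometryEquiv.contDiff _).comp hfderiv

variable {X E F : Type*} [TopologicalSpace X] [NormedAddCommGroup E] [NormedSpace ℝ E]
  [NormedAddCommGroup F] [NormedSpace ℝ F]

theorem continuous_contDiffMapSupportedIn {K : Compacts E} {ψ : X → 𝓓_{K}(E, F)}
    (hψ : ∀ i, Continuous fun q : X × E => iteratedFDeriv ℝ i (ψ q.1) q.2) : Continuous ψ := by
  rw [ContDiffMapSupportedIn.continuous_iff_comp]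
  refine fun i => continuous_iff_continuousAt.2 fun p₀ => ?_
  rw [ContinuousAt, BoundedContinuousFunction.tendsto_iff_tendstoUniformly,
    Metric.tendstoUniformly_iff]
  intro ε hε
  have hdist : Continuous fun q : X × E =>
      dist (iteratedFDeriv ℝ i (ψ p₀) q.2) (iteratedFDeriv ℝ i (ψ q.1) q.2) :=
    ((hψ i).comp (continuous_const.prodMk continuous_snd)).dist (hψ i)
  have hK := K.isCompact.eventually_forall_of_forall_eventually (x₀ := p₀)
    (P := fun p x => dist (iteratedFDeriv ℝ i (ψ p₀) x) (iteratedFDeriv ℝ i (ψ p) x) < ε)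
    fun x _ => hdist.continuousAt.eventually_lt continuousAt_const (by simpa using hε)
  filter_upwards [hK] with p hp x
  simp only [Function.comp_apply, ContDiffMapSupportedIn.structureMapCLM_top_apply]
  by_cases hx : x ∈ K
  · exact hp x hx
  · rwa [(ψ p₀).iteratedFDeriv_zero_on_compl hx, (ψ p).iteratedFDeriv_zero_on_compl hx,
      Pi.zero_apply, dist_self]

theorem continuous_testFunction {Ω : Opens E} {ψ : X → 𝓓(Ω, F)}
    (hψ : ∀ i, Continuous fun q : X × E => iteratedFDeriv ℝ i (ψ q.1) q.2)
    (hsupp : ∀ p₀, ∃ K : Compacts E, (K : Set E) ⊆ Ω ∧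
      ∀ᶠ p in 𝓝 p₀, Function.support (ψ p) ⊆ K) : Continuous ψ := by
  refine continuous_iff_continuousAt.2 fun p₀ => ?_
  obtain ⟨K, hKΩ, hK⟩ := hsupp p₀
  let U : Set X := {p | Function.support (ψ p) ⊆ K}
  let ψK : U → 𝓓_{K}(E, F) := fun p =>
    ContDiffMapSupportedIn.of_support_subset (ψ p).contDiff p.2
  have hψK : Continuous ψK := continuous_contDiffMapSupportedIn fun i =>
    (hψ i).comp ((continuous_subtype_val.comp continuous_fst).prodMk continuous_snd)
  have hψU : Continuous (U.domRestrict ψ) :=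
    (TestFunction.continuous_ofSupportedIn hKΩ).comp hψK
  exact (continuousOn_iff_continuous_domRestrict.2 hψU).continuousAt hK

end Families

section LocalFourier

variable {n : ℕ}

theorem contDiff_modulate_translateTest (χ : Test n) :
    ContDiff ℝ ∞ (Function.uncurry fun q : Rn n × Rn n => modulate q.1 (translateTest q.2 χ)) := by
  have hphase : ContDiff ℝ ∞ fun q : (Rn n × Rn n) × Rn n => inner ℝ q.2 q.1.1 :=
    contDiff_snd.inner ℝ (contDiff_fst.comp contDiff_fst)
  exact (contDiff_const.mul (Complex.ofRealCLM.contDiff.comp hphase)).neg.cexp.mul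
    (χ.contDiff.comp (contDiff_snd.sub (contDiff_snd.comp contDiff_fst)))

theorem support_modulate_translateTest_subset (ξ : Rn n) {y y₀ : Rn n}
    (hy : y ∈ Metric.closedBall y₀ 1) (χ : Test n) :
    Function.support (modulate ξ (translateTest y χ)) ⊆
      Metric.closedBall y₀ 1 + tsupport χ := by
  intro x hx
  rw [Function.mem_support, modulate_apply] at hx
  exact Set.mem_add.2 ⟨y, hy, x - y, subset_tsupport _ (right_ne_zero_of_mul hx),
    add_sub_cancel y x⟩

theorem continuous_modulate_translateTest (χ : Test n) :
    Continuous fun q : Rn n × Rn n => modulate q.1 (translateTest q.2 χ) := by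
  refine continuous_testFunction
    (fun i => (contDiff_iteratedFDeriv_of_uncurry (contDiff_modulate_translateTest χ) i).continuous)
    fun p₀ => ⟨⟨Metric.closedBall p₀.2 1 + tsupport χ,
      (isCompact_closedBall _ _).add χ.hasCompactSupport⟩, Set.subset_univ _, ?_⟩
  filter_upwards [continuous_snd.continuousAt.preimage_mem_nhds
    (Metric.closedBall_mem_nhds p₀.2 one_pos)] with p hp
  exact support_modulate_translateTest_subset p.1 hp χ

theorem continuous_localFourier (u : Distr n) (χ : Test n) :
    Continuous (Function.uncurry (localFourier u χ)) :=
  u.continuous.comp (continuous_modulate_translateTest χ)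

end LocalFourier

/-! ### Mixed norms -/

section MixedNorm

theorem essSup_eq_iSup_of_continuous {α β : Type*} [TopologicalSpace α] {m : MeasurableSpace α}
    {μ : Measure α} [μ.IsOpenPosMeasure] [CompleteLinearOrder β] [TopologicalSpace β]
    [FirstCountableTopology β] [OrderTopology β] {f : α → β} (hf : Continuous f) :
    essSup f μ = ⨆ x, f x := by
  refine le_antisymm (essSup_le_of_ae_le _ (Eventually.of_forall fun x => le_iSup f x))
    (iSup_le fun x => ?_)
  have hclosed : IsClosed {x | f x ≤ essSup f μ} := isClosed_le hf continuous_const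
  have hdense : Dense {x | f x ≤ essSup f μ} := Measure.dense_of_ae ae_le_essSup
  exact hclosed.closure_subset (hdense x)

variable {n : ℕ} {p : ℝ≥0∞}

theorem eLpNorm_le_mixedNorm (hp : p ≠ 0) (f : Rn n → ℝ≥0∞) :
    eLpNorm f p volume ≤ mixedNorm p f := by
  rcases eq_or_ne p ∞ with rfl | hp_top
  · rw [eLpNorm_exponent_top, mixedNorm, if_pos rfl]
    exact essSup_le_of_ae_le _ (Eventually.of_forall fun y => le_iSup f y)
  · simp [mixedNorm, hp_top, eLpNorm_eq_lintegral_rpow_enorm_toReal hp hp_top]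

theorem mixedNorm_enorm_eq_eLpNorm (hp : p ≠ 0) {f : Rn n → ℂ} (hf : Continuous f) :
    mixedNorm p (fun y => ‖f y‖ₑ) = eLpNorm f p volume := by
  rcases eq_or_ne p ∞ with rfl | hp_top
  · rw [eLpNorm_exponent_top, mixedNorm, if_pos rfl, eLpNormEssSup,
      essSup_eq_iSup_of_continuous hf.enorm]
  · simp [mixedNorm, hp_top, eLpNorm_eq_lintegral_rpow_enorm_toReal hp hp_top]

theorem bigU_eq_eLpNorm (hp : p ≠ 0) (u : Distr n) (χ : Test n) (ξ : Rn n) :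
    bigU p u χ ξ = eLpNorm (localFourier u χ ξ) p volume :=
  mixedNorm_enorm_eq_eLpNorm hp ((continuous_localFourier u χ).uncurry_left ξ)

theorem measurable_bigU (p : ℝ≥0∞) (u : Distr n) (χ : Test n) : Measurable (bigU p u χ) := by
  have hcont : Continuous fun q : Rn n × Rn n => ‖localFourier u χ q.1 q.2‖ₑ :=
    (continuous_localFourier u χ).enorm
  rcases eq_or_ne p ∞ with rfl | hp_top
  · have hU : bigU ∞ u χ = fun ξ => ⨆ y, ‖localFourier u χ ξ y‖ₑ := by
      ext ξ
      rw [bigU, mixedNorm, if_pos rfl]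
      rfl
    rw [hU]
    exact (lowerSemicontinuous_iSup fun y =>
      (hcont.comp (Continuous.prodMk_left y)).lowerSemicontinuous).measurable
  · have hU : bigU p u χ =
        fun ξ => (∫⁻ y, ‖localFourier u χ ξ y‖ₑ ^ p.toReal) ^ (1 / p.toReal) := by
      ext ξ
      rw [bigU, mixedNorm, if_neg hp_top]
      rfl
    rw [hU]
    exact (hcont.measurable.pow_const _).lintegral_prod_right'.pow_const _

theorem memLp_bigU_iff (u : Distr n) (χ : Test n) :
    MemLp (bigU p u χ) 1 volume ↔ normSw p χ u < ⊤ := by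
  simp [MemLp, (measurable_bigU p u χ).aestronglyMeasurable, eLpNorm_one_eq_lintegral_enorm,
    normSw]

end MixedNorm

section Windows

variable {n : ℕ} {p : ℝ≥0∞}

theorem normSw_testMul_le {k : Rn n → ℝ} (hk_meas : AEMeasurable k volume) (hk_pos : ∀ ξ, 0 < k ξ)
    {C N : ℝ} (hCN : IsWeightBound k C N) (hp : p ≠ 0) (u : Distr n) (φ χ : Test n) :
    normSw p (testMul φ χ) u ≤ windowConst C N φ * (∫⁻ ξ, ENNReal.ofReal (1 / k ξ)) *
      eLpNorm (localNorm k u χ) p volume := by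
  have hU : ∀ ξ, bigU p u (testMul φ χ) ξ ≤
      windowConst C N φ * ENNReal.ofReal (1 / k ξ) * eLpNorm (localNorm k u χ) p volume := by
    intro ξ
    have htop : windowConst C N φ * ENNReal.ofReal (1 / k ξ) ≠ ⊤ :=
      ENNReal.mul_ne_top (windowConst_ne_top C N φ) ENNReal.ofReal_ne_top
    rw [bigU_eq_eLpNorm hp, ← ENNReal.coe_toNNReal htop]
    refine eLpNorm_le_mul_eLpNorm_of_ae_le_mul' (Eventually.of_forall fun y => ?_) p
    rw [ENNReal.coe_toNNReal htop, enorm_eq_self]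
    exact enorm_localFourier_testMul_le hk_meas hk_pos hCN u φ χ ξ y
  have hinv : AEMeasurable (fun ξ => ENNReal.ofReal (1 / k ξ)) volume :=
    (hk_meas.const_div 1).ennreal_ofReal
  calc normSw p (testMul φ χ) u
    _ ≤ ∫⁻ ξ, windowConst C N φ * ENNReal.ofReal (1 / k ξ) *
        eLpNorm (localNorm k u χ) p volume := lintegral_mono hU
    _ = _ := by
      rw [lintegral_mul_const'' _ (hinv.const_mul _),
        lintegral_const_mul' _ _ (windowConst_ne_top C N φ)]

end Windows

/-! ### Finite sums of windows -/

/-- For `p < 1` the triangle inequality in `L^p` only holds up to a constant factor. -/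
theorem exists_eLpNorm_sum_le {ι α E : Type*} {m : MeasurableSpace α} (μ : Measure α)
    [NormedAddCommGroup E] (p : ℝ≥0∞) (t : Finset ι) :
    ∃ A : ℝ≥0, ∀ f : ι → α → E, (∀ i ∈ t, AEStronglyMeasurable (f i) μ) →
      eLpNorm (∑ i ∈ t, f i) p μ ≤ A * ∑ i ∈ t, eLpNorm (f i) p μ := by
  classical
  induction t using Finset.induction_on with
  | empty => exact ⟨0, fun f _ => by simp⟩
  | insert i t hi ih =>
    obtain ⟨A, hA⟩ := ih
    have hL := ENNReal.coe_toNNReal (ENNReal.LpAddConst_lt_top p).ne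
    refine ⟨(ENNReal.LpAddConst p).toNNReal * (1 + A), fun f hf => ?_⟩
    rw [Finset.forall_mem_insert] at hf
    rw [Finset.sum_insert hi, Finset.sum_insert hi, ENNReal.coe_mul, hL, ENNReal.coe_add,
      ENNReal.coe_one, mul_assoc]
    refine (eLpNorm_add_le' hf.1 (Finset.aestronglyMeasurable_sum _ hf.2) p).trans ?_
    gcongr
    calc eLpNorm (f i) p μ + eLpNorm (∑ j ∈ t, f j) p μ
      _ ≤ eLpNorm (f i) p μ + A * ∑ j ∈ t, eLpNorm (f j) p μ := by
        gcongr
        exact hA f hf.2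
      _ ≤ (1 + A) * (eLpNorm (f i) p μ + ∑ j ∈ t, eLpNorm (f j) p μ) := by
        rw [add_mul, one_mul, mul_add]
        exact add_le_add le_self_add le_add_self

theorem sum_testFunction_apply {ι E F : Type*} [NormedAddCommGroup E] [NormedSpace ℝ E]
    [NormedAddCommGroup F] [NormedSpace ℝ F] {Ω : Opens E} (t : Finset ι) (f : ι → 𝓓(Ω, F))
    (x : E) : (∑ i ∈ t, f i) x = ∑ i ∈ t, f i x :=
  map_sum (⟨⟨fun g : 𝓓(Ω, F) => g x, rfl⟩, fun _ _ => rfl⟩ : 𝓓(Ω, F) →+ F) f t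

section Sums

variable {n : ℕ} {p : ℝ≥0∞} {ι : Type*}

theorem localFourier_sum (u : Distr n) (t : Finset ι) (χ : ι → Test n) (ξ : Rn n) :
    localFourier u (∑ i ∈ t, χ i) ξ = ∑ i ∈ t, localFourier u (χ i) ξ := by
  ext y
  simp only [localFourier, Finset.sum_apply, ← map_sum]
  congr 1
  ext x
  simp only [modulate_apply, translateTest_apply, sum_testFunction_apply, Finset.mul_sum]

theorem exists_normSw_sum_le (n : ℕ) (hp : p ≠ 0) (t : Finset ι) :
    ∃ A : ℝ≥0, ∀ (u : Distr n) (χ : ι → Test n),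
      normSw p (∑ i ∈ t, χ i) u ≤ A * ∑ i ∈ t, normSw p (χ i) u := by
  obtain ⟨A, hA⟩ := exists_eLpNorm_sum_le (E := ℂ) (volume : Measure (Rn n)) p t
  refine ⟨A, fun u χ => ?_⟩
  have hU : ∀ ξ, bigU p u (∑ i ∈ t, χ i) ξ ≤ A * ∑ i ∈ t, bigU p u (χ i) ξ := fun ξ => by
    simp only [bigU_eq_eLpNorm hp, localFourier_sum]
    exact hA _ fun i _ => ((continuous_localFourier u (χ i)).uncurry_left ξ).aestronglyMeasurable
  calc normSw p (∑ i ∈ t, χ i) u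
    _ ≤ ∫⁻ ξ, A * ∑ i ∈ t, bigU p u (χ i) ξ := lintegral_mono hU
    _ = A * ∑ i ∈ t, normSw p (χ i) u := by
      rw [lintegral_const_mul' _ _ ENNReal.coe_ne_top,
        lintegral_finsetSum _ fun i _ => measurable_bigU p u (χ i)]
      rfl

end Sums

/-! ### Change of window -/

section Partition

theorem exists_finset_forall_exists_sub_ne_zero {G M : Type*} [TopologicalSpace G]
    [AddGroup G] [ContinuousSub G] [TopologicalSpace M] [T1Space M] [Zero M] {K : Set G}
    (hK : IsCompact K) {f : G → M} (hf : Continuous f) {x₀ : G} (hx₀ : f x₀ ≠ 0) :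
    ∃ t : Finset G, ∀ x ∈ K, ∃ a ∈ t, f (x - a) ≠ 0 := by
  obtain ⟨t, ht⟩ := hK.elim_finite_subcover (fun a => {x | f (x - a) ≠ 0})
    (fun a => isOpen_compl_singleton.preimage (hf.comp (continuous_id.sub continuous_const)))
    fun x _ => Set.mem_iUnion.2 ⟨-x₀ + x, by simpa using hx₀⟩
  exact ⟨t, fun x hx => by simpa using ht hx⟩

theorem exists_testFunction_mul_eq {E A : Type*} [NormedAddCommGroup E] [NormedSpace ℝ E]
    [NormedField A] [NormedAlgebra ℝ A] {Ω : Opens E} (χ : 𝓓(Ω, A)) {Ψ : E → A}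
    (hΨ : ContDiff ℝ ∞ Ψ) (hΨ_ne : ∀ x ∈ tsupport χ, Ψ x ≠ 0) :
    ∃ θ : 𝓓(Ω, A), ∀ x, θ x * Ψ x = χ x := by
  have hsub : tsupport (fun x => χ x * (Ψ x)⁻¹) ⊆ tsupport χ := tsupport_mul_subset_left
  have hsmooth : ContDiff ℝ ∞ fun x => χ x * (Ψ x)⁻¹ :=
    contMDiff_iff_contDiff.1 <| contMDiff_of_tsupport fun x hx =>
      (χ.contDiff.contDiffAt.mul (hΨ.contDiffAt.inv (hΨ_ne x (hsub hx)))).contMDiffAt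
  refine ⟨⟨fun x => χ x * (Ψ x)⁻¹, hsmooth, χ.hasCompactSupport.mul_right,
    hsub.trans χ.tsupport_subset⟩, fun x => ?_⟩
  change χ x * (Ψ x)⁻¹ * Ψ x = χ x
  by_cases hx : x ∈ tsupport χ
  · exact inv_mul_cancel_right₀ (hΨ_ne x hx) _
  · simp [image_eq_zero_of_notMem_tsupport hx]

variable {n : ℕ}

/-- The complex conjugate of a test function. -/
def conjTest (χ : Test n) : Test n where
  toFun x := star (χ x)
  contDiff' := (starL' ℝ : ℂ ≃L[ℝ] ℂ).contDiff.comp χ.contDiff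
  hasCompactSupport' := χ.hasCompactSupport.comp_left (star_zero ℂ)
  tsupport_subset' := Set.subset_univ _

theorem exists_eq_sum_testMul_translateTest (χ : Test n) {χ' : Test n} (hχ' : χ' ≠ 0) :
    ∃ (t : Finset (Rn n)) (φ : Rn n → Test n),
      χ = ∑ a ∈ t, testMul (φ a) (translateTest a χ') := by
  obtain ⟨x₀, hx₀⟩ := DFunLike.ne_iff.1 hχ'
  obtain ⟨t, ht⟩ := exists_finset_forall_exists_sub_ne_zero χ.hasCompactSupport
    χ'.continuous hx₀
  let Ψ : Rn n → ℂ := fun x => ((∑ a ∈ t, ‖translateTest a χ' x‖ ^ 2 : ℝ) : ℂ)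
  have hΨ : ContDiff ℝ ∞ Ψ := Complex.ofRealCLM.contDiff.comp
    (ContDiff.sum fun a _ => (translateTest a χ').contDiff.norm_sq ℝ)
  have hΨ_ne : ∀ x ∈ tsupport χ, Ψ x ≠ 0 := fun x hx => by
    obtain ⟨a, ha_mem, ha⟩ := ht x hx
    have hpos : 0 < ∑ a ∈ t, ‖translateTest a χ' x‖ ^ 2 :=
      Finset.sum_pos' (fun _ _ => sq_nonneg _) ⟨a, ha_mem, pow_pos (norm_pos_iff.2 ha) 2⟩
    exact Complex.ofReal_ne_zero.2 hpos.ne'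
  obtain ⟨θ, hθ⟩ := exists_testFunction_mul_eq χ hΨ hΨ_ne
  refine ⟨t, fun a => testMul θ (conjTest (translateTest a χ')), ?_⟩
  ext x
  have hconj : ∀ a, conjTest (translateTest a χ') x * translateTest a χ' x =
      ((‖translateTest a χ' x‖ ^ 2 : ℝ) : ℂ) := fun a => by
    rw [Complex.ofReal_pow]
    exact Complex.conj_mul' _
  simp only [sum_testFunction_apply, testMul_apply, mul_assoc, hconj, ← Finset.mul_sum,
    ← Complex.ofReal_sum]
  exact (hθ x).symm

theorem eq_testMul_self {χ χ' : Test n} (h : ∀ x ∈ tsupport χ, χ' x = 1) :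
    χ = testMul χ χ' := by
  ext x
  by_cases hx : x ∈ tsupport χ
  · rw [testMul_apply, h x hx, mul_one]
  · rw [testMul_apply, image_eq_zero_of_notMem_tsupport hx, zero_mul]

end Partition

theorem exists_normSw_le {n : ℕ} {k : Rn n → ℝ} (hk : IsPolWeight k)
    (hk_int : Integrable (fun ξ => 1 / k ξ) volume) {p : ℝ≥0∞} (hp : p ≠ 0) (χ : Test n)
    {χ' : Test n} (hχ' : χ' ≠ 0) :
    ∃ A : ℝ≥0, ∀ u, normSw p χ u ≤ A * eLpNorm (localNorm k u χ') p volume := by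
  obtain ⟨hk_meas, hk_pos, C, N, hCN⟩ := hk
  obtain ⟨t, φ, hφ⟩ := exists_eq_sum_testMul_translateTest χ hχ'
  obtain ⟨B, hB⟩ := exists_normSw_sum_le n hp t
  let S : ℝ≥0∞ := ∑ a ∈ t, windowConst C N (φ a) * ∫⁻ ξ, ENNReal.ofReal (1 / k ξ)
  have hS : S ≠ ⊤ := ENNReal.sum_ne_top.2 fun a _ =>
    ENNReal.mul_ne_top (windowConst_ne_top C N (φ a)) hk_int.lintegral_lt_top.ne
  refine ⟨B * S.toNNReal, fun u => ?_⟩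
  calc normSw p χ u
    _ ≤ B * ∑ a ∈ t, normSw p (testMul (φ a) (translateTest a χ')) u := by
      conv_lhs => rw [hφ]
      exact hB u _
    _ ≤ B * ∑ a ∈ t, windowConst C N (φ a) * (∫⁻ ξ, ENNReal.ofReal (1 / k ξ)) *
        eLpNorm (localNorm k u χ') p volume := by
      gcongr with a
      rw [← eLpNorm_localNorm_translateTest k p u a χ']
      exact normSw_testMul_le hk_meas hk_pos hCN hp u (φ a) (translateTest a χ')
    _ = (B * S.toNNReal : ℝ≥0) * eLpNorm (localNorm k u χ') p volume := by
      rw [← Finset.sum_mul, ENNReal.coe_mul, ENNReal.coe_toNNReal hS, mul_assoc]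

end KatoSobolev

end

theorem mainTheorem9_general (n : ℕ) (k : Rn n → ℝ) (hk : IsPolWeight k)
    (hk1 : Integrable (fun ξ => 1 / k ξ) volume) (p : ℝ≥0∞) (hp : p ≠ 0) :
    (∀ u : Distr n, MemB k p u → MemSw p u) ∧
    (∀ χ χ' : Test n, χ' ≠ 0 →
      ∃ A : NNReal, ∀ u : Distr n, normSw p χ u ≤ A * normB k p χ' u) ∧
    (∀ C N : ℝ, IsWeightBound k C N →
      ∀ χ χ' : Test n, (∀ x ∈ tsupport χ, χ' x = 1) → ∀ u : Distr n,
        normSw p χ u ≤ ENNReal.ofReal ((2 * Real.pi) ^ (-(n : ℝ)) * C) * sobolevNorm N χ *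
          (∫⁻ ξ, ENNReal.ofReal (1 / k ξ)) * normB k p χ' u) := by
  refine ⟨?_, fun χ χ' hχ' => ?_, fun C N hCN χ χ' hχχ' u => ?_⟩
  · rintro u ⟨χ, hχ, hmem⟩
    obtain ⟨A, hA⟩ := exists_normSw_le hk hk1 hp χ hχ
    exact ⟨χ, hχ, (memLp_bigU_iff u χ).2
      ((hA u).trans_lt (ENNReal.mul_lt_top ENNReal.coe_lt_top hmem.2))⟩
  · obtain ⟨A, hA⟩ := exists_normSw_le hk hk1 hp χ hχ'
    exact ⟨A, fun u => (hA u).trans (mul_le_mul_right (eLpNorm_le_mixedNorm hp _) _)⟩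
  · have hbound := normSw_testMul_le hk.1 hk.2.1 hCN hp u χ χ'
    rw [← eq_testMul_self hχχ'] at hbound
    exact hbound.trans (mul_le_mul_right (eLpNorm_le_mixedNorm hp _) _)

theorem mainTheorem9 (n : ℕ) (k : Rn n → ℝ) (hk : IsPolWeight k)
    (hk1 : Integrable (fun ξ => 1 / k ξ) volume) (p : ℝ≥0∞) (hp : 1 ≤ p) :
    (∀ u : Distr n, MemB k p u → MemSw p u) ∧
    (∀ χ χ' : Test n, χ ≠ 0 → χ' ≠ 0 →
      ∃ A : NNReal, ∀ u : Distr n, MemB k p u → normSw p χ u ≤ A * normB k p χ' u) ∧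
    (∀ C N : ℝ, IsWeightBound k C N →
      ∀ χ χ' : Test n, χ ≠ 0 → (∀ x ∈ tsupport χ, χ' x = 1) →
      ∀ u : Distr n, MemB k p u →
        normSw p χ u ≤ ENNReal.ofReal ((2 * Real.pi) ^ (-(n : ℝ)) * C) * sobolevNorm N χ *
          (∫⁻ ξ, ENNReal.ofReal (1 / k ξ)) * normB k p χ' u) := by
  obtain ⟨hmem, hle, hbound⟩ := mainTheorem9_general n k hk hk1 p (zero_lt_one.trans_le hp).ne'
  exact ⟨hmem, fun χ χ' _ hχ' => (hle χ χ' hχ').imp fun _ hA u _ => hA u,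
    fun C N hCN χ χ' _ hχχ' u _ => hbound C N hCN χ χ' hχχ' u⟩
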